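/- Let $q$ be a formal variable, and write $(a;q)_\infty=\prod_{j\ge 0}(1-aq^j)$, $(a;q)_n=\prod_{j=0}^{n-1}(1-aq^j)$ for $n\ge 0$, $(q)_n=(q;q)_n$, $(q)_\infty=(q;q)_\infty$ and $(a_1,\dots,a_k;q)_\infty=(a_1;q)_\infty\cdots(a_k;q)_\infty$. For integers $m\ge 0$ and $0\le r\le 2m$ put $$\sigma(m,r)=\frac{(-1)^r q^{\frac32 r^2+\frac12 r}\,(q^2;q^3)_r}{(q^2;q^3)_{2m}\,(q^3;q^3)_{2m-r}\,(q)_{3r}} .$$ Then the following identity holds in the field $\mathbb{Q}((q))$ of formal Laurent series, where the infinite sum and the infinite products converge $q$-adically: $$\sum_{m=0}^\infty\sum_{r=0}^{2m} q^{9m^2-3m}\,\sigma(m,r)\left(q^{2-6m}\Big(q^{6m}-\frac{1-q^{6m+1}}{1-q^{3r+1}}\Big)+1+\frac{q^{6m}}{1-q^{6m+2}}\Big(\frac{1}{1-q^{3r+1}}-1\Big)\right)$$ $$=\frac{(q^2,q^4,q^6;q^6)_\infty\,(q^2,q^{10};q^{12})_\infty}{(q)_\infty}=(-q;q^2)_\infty\,(-q^6;q^6)_\infty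 .$$ For every $n\ge 0$ the coefficient of $q^n$ in this common value is the number of partitions of $n$ into distinct parts not congruent to $\pm 2$ modulo $6$, so that the double sum is a series expression for the partition function in Capparelli's second identity. -/

import Mathlib

namespace QSeries

noncomputable section

/-- The infinite rising `q`-factorial `(a;q)_∞ = ∏_{j ≥ 0} (1 - a q^j)`. -/
def qPochInf {K : Type*} [Field K] [TopologicalSpace K] (a q : K) : K :=
  ∏' j : ℕ, (1 - a * q ^ j)

/-- The finite rising `q`-factorial `(a;q)_n = ∏_{0 ≤ j < n} (1 - a q^j)`, for `n ≥ 0`. -/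
def qPoch {K : Type*} [Field K] (a q : K) (n : ℕ) : K :=
  ∏ j ∈ Finset.range n, (1 - a * q ^ j)

/-- The formal variable `q`, as an element of the field of formal Laurent series `ℚ((q))`, which
carries its `q`-adic topology. -/
def qVar : LaurentSeries ℚ := HahnSeries.single 1 1

/-- `σ(m,r) = (-1)^r q^{(3/2) r² + r/2} (q²;q³)_r / ((q²;q³)_{2m} (q³;q³)_{2m-r} (q;q)_{3r})`
for `0 ≤ r ≤ 2m`.  The integer `r(3r+1)` is even, so the exponent is an exact quotient. -/
def sigma (m r : ℕ) : LaurentSeries ℚ :=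
  (-1) ^ r * qVar ^ (r * (3 * r + 1) / 2) * qPoch (qVar ^ 2) (qVar ^ 3) r /
    (qPoch (qVar ^ 2) (qVar ^ 3) (2 * m) * qPoch (qVar ^ 3) (qVar ^ 3) (2 * m - r) *
      qPoch qVar qVar (3 * r))

/-- The number of partitions of `n` into distinct parts not congruent to `± 2` modulo `6`. -/
def capparelliCount (n : ℕ) : ℕ :=
  (Finset.univ.filter fun p : n.Partition =>
    p.parts.Nodup ∧ ∀ i ∈ p.parts, ¬ i ≡ 2 [MOD 6] ∧ ¬ i ≡ 4 [MOD 6]).card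

/-- Embedding formal power series into formal Laurent series is continuous for the `q`-adic
topologies. -/
theorem continuous_ofPowerSeries :
    @Continuous (PowerSeries ℚ) (LaurentSeries ℚ)
      (@PowerSeries.WithPiTopology.instTopologicalSpace ℚ ⊥) inferInstance
      (HahnSeries.ofPowerSeries ℤ ℚ) := by
  let _ : TopologicalSpace ℚ := ⊥
  have _ : DiscreteTopology ℚ := ⟨rfl⟩
  let _ := PowerSeries.WithPiTopology.instTopologicalSpace ℚ
  have _ := PowerSeries.WithPiTopology.instIsTopologicalRing ℚ
  refine continuous_of_continuousAt_zero (HahnSeries.ofPowerSeries ℤ ℚ) ?_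
  rw [ContinuousAt, map_zero]
  intro s hs
  obtain ⟨γ, hγ⟩ := Valued.mem_nhds_zero.mp hs
  simp only [Valuation.restrict_lt_iff_lt_embedding] at hγ
  have hne : MonoidWithZeroHom.ValueGroup₀.embedding (γ : MonoidWithZeroHom.ValueGroup₀
      (.ofClass (Valued.v (R := LaurentSeries ℚ)))) ≠ 0 := by
    simp
  obtain ⟨D, hD⟩ : ∃ D : ℕ, WithZero.exp (-(D : ℤ)) <
      MonoidWithZeroHom.ValueGroup₀.embedding (γ : MonoidWithZeroHom.ValueGroup₀
      (.ofClass (Valued.v (R := LaurentSeries ℚ)))) := by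
    refine ⟨(1 - WithZero.log (MonoidWithZeroHom.ValueGroup₀.embedding
      (γ : MonoidWithZeroHom.ValueGroup₀
      (.ofClass (Valued.v (R := LaurentSeries ℚ)))))).toNat, ?_⟩
    rw [← WithZero.lt_log_iff_exp_lt hne]
    have := Int.self_le_toNat (1 - WithZero.log (MonoidWithZeroHom.ValueGroup₀.embedding
      (γ : MonoidWithZeroHom.ValueGroup₀
      (.ofClass (Valued.v (R := LaurentSeries ℚ))))))
    linarith
  have hev : ∀ᶠ f : PowerSeries ℚ in nhds 0, ∀ n ∈ Finset.range D,
      PowerSeries.coeff n f = 0 := by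
    rw [Filter.eventually_all_finset]
    intro n _
    have h := (PowerSeries.WithPiTopology.continuous_coeff ℚ n).tendsto 0
    rw [map_zero, nhds_discrete ℚ] at h
    exact h (Set.mem_singleton (0 : ℚ))
  rw [Filter.mem_map]
  filter_upwards [hev] with f hf
  apply hγ
  refine lt_of_le_of_lt ?_ hD
  exact (LaurentSeries.intValuation_le_iff_coeff_lt_eq_zero ℚ f).mpr
    fun n hn => hf n (Finset.mem_range.mpr (by exact_mod_cast hn))

/-- The infinite product defining `(c q^s; q^t)_∞` converges `q`-adically when `s ≥ 0, t ≥ 1`. -/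
theorem multipliable_qPochInf (c : ℚ) (s : ℕ) {t : ℕ} (ht : 1 ≤ t) :
    Multipliable fun j : ℕ =>
      (1 : LaurentSeries ℚ) - HahnSeries.C c * qVar ^ s * (qVar ^ t) ^ j := by
  let _ : TopologicalSpace ℚ := ⊥
  have _ : DiscreteTopology ℚ := ⟨rfl⟩
  let _ := PowerSeries.WithPiTopology.instTopologicalSpace ℚ
  have h : Multipliable fun j : ℕ =>
      (1 : PowerSeries ℚ) + (-(PowerSeries.C c * PowerSeries.X ^ s * (PowerSeries.X ^ t) ^ j)) := by
    apply PowerSeries.WithPiTopology.multipliable_one_add_of_tendsto_order_atTop_nhds_top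
    refine ENat.tendsto_nhds_top_iff_natCast_lt.mpr
      fun n => Filter.eventually_atTop.mpr ⟨n + 1, fun m hm => ?_⟩
    have hle : ((n + 1 : ℕ) : ℕ∞) ≤
        (-(PowerSeries.C c * PowerSeries.X ^ s * (PowerSeries.X ^ t) ^ m) : PowerSeries ℚ).order := by
      refine PowerSeries.nat_le_order _ _ fun i hi => ?_
      rw [map_neg, ← pow_mul, PowerSeries.coeff_mul_X_pow', if_neg, neg_zero]
      have : m ≤ t * m := Nat.le_mul_of_pos_left m ht
      omega
    exact lt_of_lt_of_le (by exact_mod_cast Nat.lt_succ_self n) hle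
  have h2 := h.map (HahnSeries.ofPowerSeries ℤ ℚ) continuous_ofPowerSeries
  convert h2 using 2 with j
  simp [qVar, sub_eq_add_neg, HahnSeries.ofPowerSeries_X, HahnSeries.ofPowerSeries_C]

end

end QSeries

/-! Let ω be a primitive third root of unity and let R_n be the coefficient of z^n in
1/((ωz;q)_∞(ω⁻¹z;q)_∞) = (z;q)_∞/(z³;q³)_∞, so that (1 - q^n) R_n = -R_{n-1} - R_{n-2}. The whole
double sum is the single series ∑ q^{n(n-1)} R_{2n}, taken three terms at a time.

Two terminating sums make this visible: ∑_r σ(m,r) = R_{6m} and ∑_r σ(m,r)/(1 - q^{3r+1}) =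
-R_{6m+1}. Both come from `qPoch_mul_eq_sum_cubicWeight`, where the sums are shown to obey the
recurrence of R. Running that recurrence one way or the other from R_{6m} and R_{6m+1}, the three
pieces of the summand become the terms with n = 3m-1, 3m, 3m+1 (`sum_sigma_eq`).

The single series is then evaluated by a Bailey-type argument (`hasSum_rogersSzego`). One has R_{2n}
= ∑_j θ_j/((q)_{n-j}(q)_{n+j}) with θ_0 = 1 and θ_j = ω^j + ω^{-j} otherwise. After exchanging sums,
the inner sums are Durfee-type series, all multiples of 1/(q)_∞ (`durfeeSum_mul`). What remains is
the theta series ∑_j t_j q^{j(j+1)} with t = 1, -2, 1 repeated, which the triple product at ω turns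
into (q²;q²)_∞ ∏_{i≥1}(1 - q^{2i} + q^{4i}) (`hasSum_tripleCoeff_eq`).

Finally (1 - x + x²)(1 + x) = 1 + x³, together with Euler's (q;q²)_∞(-q;q)_∞ = 1, gives both product
forms (`eulerProd_relations`). The second one visibly generates distinct parts that are odd or
divisible by 6. -/

namespace QSeries

/-! ### Terminating sums for the coefficients of (z;q)_∞/(z³;q³)_∞. -/

section FiniteIdentities

variable {K : Type*} [Field K]

theorem qPoch_zero (a q : K) : qPoch a q 0 = 1 := by simp [qPoch]

theorem qPoch_succ (a q : K) (n : ℕ) :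
    qPoch a q (n + 1) = qPoch a q n * (1 - a * q ^ n) := by
  simp [qPoch, Finset.prod_range_succ]

theorem qPoch_pow_ne_zero {q : K} (hq : ∀ n, 1 - q ^ (n + 1) ≠ 0) (s t n : ℕ) :
    qPoch (q ^ (s + 1)) (q ^ t) n ≠ 0 := by
  refine Finset.prod_ne_zero_iff.mpr fun j _ => ?_
  have := hq (s + t * j)
  rwa [show s + t * j + 1 = (s + 1) + t * j by ring, pow_add, pow_mul] at this

/-- The part of the summand `σ(m,r)` that depends on `r` only. -/
def cubicWeight (q : K) (r : ℕ) : K :=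
  (-1) ^ r * q ^ (r * (3 * r + 1) / 2) * qPoch (q ^ 2) (q ^ 3) r / qPoch q q (3 * r)

/-- The new factor 1 - q^{3r+2} of (q²;q³)_{r+1} cancels against one of the three new factors of
(q)_{3r+3}, and the exponent of q grows by 3r+2. This is what couples the plain sum to the one
carrying 1/(1 - q^{3r+1}). -/
theorem cubicWeight_succ {q : K} (hq : ∀ n, 1 - q ^ (n + 1) ≠ 0) (r : ℕ) :
    cubicWeight q (r + 1) * (1 - q ^ (3 * r + 3)) =
      -q ^ (3 * r + 2) * (cubicWeight q r / (1 - q ^ (3 * r + 1))) := by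
  have e : (r + 1) * (3 * (r + 1) + 1) / 2 = r * (3 * r + 1) / 2 + (3 * r + 2) := by
    rw [← Nat.add_mul_div_right _ _ (by norm_num : 0 < 2)]
    congr 1
    ring
  have h0 : qPoch q q (3 * r) ≠ 0 := by simpa using qPoch_pow_ne_zero hq 0 1 (3 * r)
  have h1 := hq (3 * r)
  have h2 := hq (3 * r + 1)
  have h3 := hq (3 * r + 2)
  rw [cubicWeight, cubicWeight, e, show 3 * (r + 1) = 3 * r + 1 + 1 + 1 by ring, qPoch_succ,
    qPoch_succ, qPoch_succ, qPoch_succ, ← pow_succ' q, ← pow_succ' q, ← pow_succ' q, ← pow_mul,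
    ← pow_add, add_comm 2 (3 * r), pow_add q (r * (3 * r + 1) / 2)]
  field_simp
  ring

theorem sum_cubicWeight_succ {q : K} (hq : ∀ n, 1 - q ^ (n + 1) ≠ 0) (n : ℕ) :
    (1 - q ^ (3 * n + 3)) *
        ∑ r ∈ Finset.range (n + 2), cubicWeight q r / qPoch (q ^ 3) (q ^ 3) (n + 1 - r) =
      ∑ r ∈ Finset.range (n + 1), cubicWeight q r / qPoch (q ^ 3) (q ^ 3) (n - r) -
        q ^ (3 * n + 2) * ∑ r ∈ Finset.range (n + 1),
          cubicWeight q r / (1 - q ^ (3 * r + 1)) / qPoch (q ^ 3) (q ^ 3) (n - r) := by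
  -- Split 1 - q^{3(n+1)} = (1 - q^{3(n+1-r)}) + q^{3(n+1-r)}(1 - q^{3r}): the first piece shortens
  -- the Pochhammer symbol, the second lowers r through `cubicWeight_succ`.
  have key : ∀ r ∈ Finset.range (n + 2),
      (1 - q ^ (3 * n + 3)) * (cubicWeight q r / qPoch (q ^ 3) (q ^ 3) (n + 1 - r)) =
      cubicWeight q r * (1 - q ^ (3 * (n + 1 - r))) / qPoch (q ^ 3) (q ^ 3) (n + 1 - r) +
      q ^ (3 * (n + 1 - r)) * (cubicWeight q r * (1 - q ^ (3 * r))) /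
        qPoch (q ^ 3) (q ^ 3) (n + 1 - r) := by
    intro r hr
    have hr' : r ≤ n + 1 := by simpa [Nat.lt_succ_iff] using hr
    obtain ⟨d, hd⟩ := Nat.exists_eq_add_of_le hr'
    rw [hd, show 3 * n + 3 = 3 * r + 3 * d by omega, Nat.add_sub_cancel_left, pow_add]
    ring
  rw [Finset.mul_sum, Finset.sum_congr rfl key, Finset.sum_add_distrib, sub_eq_add_neg]
  congr 1
  · rw [Finset.sum_range_succ]
    simp only [Nat.sub_self, mul_zero, pow_zero, sub_self, zero_div, add_zero]
    refine Finset.sum_congr rfl fun r hr => ?_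
    have hr' : r ≤ n := by simpa [Nat.lt_succ_iff] using hr
    have := hq (3 * (n - r) + 2)
    rw [Nat.succ_sub hr', Nat.succ_eq_add_one, qPoch_succ, ← pow_succ' (q ^ 3), ← pow_mul]
    rw [show 3 * (n - r) + 2 + 1 = 3 * (n - r + 1) by ring] at this
    rw [mul_div_mul_right _ _ this]
  · rw [Finset.sum_range_succ']
    simp only [mul_zero, pow_zero, sub_self, zero_div, add_zero]
    rw [Finset.mul_sum, ← Finset.sum_neg_distrib]
    refine Finset.sum_congr rfl fun r hr => ?_
    have hr' : r ≤ n := by simpa [Nat.lt_succ_iff] using hr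
    obtain ⟨d, rfl⟩ := Nat.exists_eq_add_of_le hr'
    rw [show 3 * (r + 1) = 3 * r + 3 by ring, cubicWeight_succ hq,
      show r + d + 1 - (r + 1) = d by omega, show r + d - r = d by omega,
      show 3 * (r + d) + 2 = 3 * d + (3 * r + 2) by ring, pow_add]
    ring

/-- Termwise, (1 - q^{3n+4})/(1 - q^{3r+1}) - 1 = q^{3r+1}(1 - q^{3(n+1-r)})/(1 - q^{3r+1}). The
numerator shortens the Pochhammer symbol and kills r = n+1, while q^{3r+1}/(1 - q^{3r+1}) = 1/(1 -
q^{3r+1}) - 1. -/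
theorem sum_cubicWeight_div_succ {q : K} (hq : ∀ n, 1 - q ^ (n + 1) ≠ 0) (n : ℕ) :
    (1 - q ^ (3 * n + 4)) * ∑ r ∈ Finset.range (n + 2),
          cubicWeight q r / (1 - q ^ (3 * r + 1)) / qPoch (q ^ 3) (q ^ 3) (n + 1 - r) =
      ∑ r ∈ Finset.range (n + 2), cubicWeight q r / qPoch (q ^ 3) (q ^ 3) (n + 1 - r) +
      (∑ r ∈ Finset.range (n + 1),
          cubicWeight q r / (1 - q ^ (3 * r + 1)) / qPoch (q ^ 3) (q ^ 3) (n - r) -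
        ∑ r ∈ Finset.range (n + 1), cubicWeight q r / qPoch (q ^ 3) (q ^ 3) (n - r)) := by
  rw [← sub_eq_iff_eq_add', Finset.mul_sum, ← Finset.sum_sub_distrib, ← Finset.sum_sub_distrib,
    Finset.sum_range_succ]
  have hlast := hq (3 * n + 3)
  rw [show 3 * (n + 1) + 1 = 3 * n + 4 by ring, Nat.sub_self, qPoch_zero, div_one, div_one,
    mul_div_cancel₀ _ hlast, sub_self, add_zero]
  refine Finset.sum_congr rfl fun r hr => ?_
  have hr' : r ≤ n := by simpa [Nat.lt_succ_iff] using hr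
  obtain ⟨d, rfl⟩ := Nat.exists_eq_add_of_le hr'
  have h1 := hq (3 * r)
  have h2 := hq (3 * d + 2)
  have h3 : qPoch (q ^ 3) (q ^ 3) d ≠ 0 := qPoch_pow_ne_zero hq 2 3 d
  rw [show r + d + 1 - r = d + 1 by omega, show r + d - r = d by omega, qPoch_succ,
    ← pow_succ' (q ^ 3), ← pow_mul, show 3 * (d + 1) = 3 * d + 2 + 1 by ring]
  field_simp
  rw [show 3 * (r + d) + 4 = 3 * r + 3 * d + 4 by ring]
  ring

/-- A sequence obeying the recurrence of the coefficients of `(z;q)_∞ / (z³;q³)_∞` is given along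
the residue classes `0` and `1` modulo `3` by terminating sums. -/
theorem qPoch_mul_eq_sum_cubicWeight {q : K} (hq : ∀ n, 1 - q ^ (n + 1) ≠ 0) {f : ℕ → K}
    (h0 : f 0 = 1) (h1 : (1 - q) * f 1 = -1)
    (hf : ∀ n, (1 - q ^ (n + 2)) * f (n + 2) = -f (n + 1) - f n) (n : ℕ) :
    qPoch (q ^ 2) (q ^ 3) n * f (3 * n) =
        ∑ r ∈ Finset.range (n + 1), cubicWeight q r / qPoch (q ^ 3) (q ^ 3) (n - r) ∧
      -(qPoch (q ^ 2) (q ^ 3) n * f (3 * n + 1)) = ∑ r ∈ Finset.range (n + 1),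
          cubicWeight q r / (1 - q ^ (3 * r + 1)) / qPoch (q ^ 3) (q ^ 3) (n - r) := by
  induction n with
  | zero =>
    have := hq 0
    simp only [zero_add, pow_one] at this
    simp only [qPoch_zero, cubicWeight, Finset.sum_range_one, mul_zero, h0, zero_mul, zero_add,
      Nat.zero_div, pow_zero, pow_one, Nat.sub_zero]
    refine ⟨by simp, ?_⟩
    field_simp
    linear_combination -h1
  | succ n ih =>
    obtain ⟨ihS, ihU⟩ := ih
    have e2 := hf (3 * n)
    have e3 := hf (3 * n + 1)
    have e4 := hf (3 * n + 2)
    have hQ : qPoch (q ^ 2) (q ^ 3) (n + 1) = qPoch (q ^ 2) (q ^ 3) n * (1 - q ^ (3 * n + 2)) := by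
      rw [qPoch_succ, ← pow_mul, ← pow_add, add_comm 2]
    have hS := sum_cubicWeight_succ hq n
    have hU := sum_cubicWeight_div_succ hq n
    rw [← ihS, ← ihU] at hS hU
    have A : qPoch (q ^ 2) (q ^ 3) (n + 1) * f (3 * (n + 1)) =
        ∑ r ∈ Finset.range (n + 1 + 1), cubicWeight q r / qPoch (q ^ 3) (q ^ 3) (n + 1 - r) := by
      refine mul_left_cancel₀ (hq (3 * n + 2)) ?_
      rw [show 3 * n + 2 + 1 = 3 * n + 3 by ring, hS, hQ, show 3 * (n + 1) = 3 * n + 1 + 2 by ring]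
      rw [show 3 * n + 1 + 2 = 3 * n + 3 by ring, show 3 * n + 1 + 1 = 3 * n + 2 by ring] at e3
      -- The value f(3n+2) has no terminating sum here. It is eliminated by `e2`, whose factor 1 -
      -- q^{3n+2} is the one gained by (q²;q³)_{n+1}.
      linear_combination qPoch (q ^ 2) (q ^ 3) n * (1 - q ^ (3 * n + 2)) * e3 -
        qPoch (q ^ 2) (q ^ 3) n * e2
    refine ⟨A, mul_left_cancel₀ (hq (3 * n + 3)) ?_⟩
    rw [show 3 * n + 3 + 1 = 3 * n + 4 by ring, hU, ← A, hQ,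
      show 3 * (n + 1) = 3 * n + 3 by ring]
    rw [show 3 * n + 2 + 2 = 3 * n + 4 by ring] at e4
    linear_combination -qPoch (q ^ 2) (q ^ 3) n * (1 - q ^ (3 * n + 2)) * e4 +
        qPoch (q ^ 2) (q ^ 3) n * e2

end FiniteIdentities

/-! ### Algebraic identities for R_n and the finite triple product. -/

noncomputable section PowerSeriesIdentities

open PowerSeries Filter
open Finset.HasAntidiagonal (antidiagonal mem_antidiagonal)
open scoped PowerSeries.WithPiTopology Topology

variable {k : Type*} [Field k]

/-- `1 / (q^s;q^s)_n` as a formal power series in `q`. -/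
def invEuler (k : Type*) [Field k] (s n : ℕ) : k⟦X⟧ :=
  (∏ i ∈ Finset.range n, (1 - X ^ (s * (i + 1))) : k⟦X⟧)⁻¹

theorem prod_mul_invEuler {s : ℕ} (hs : 0 < s) (n : ℕ) :
    (∏ i ∈ Finset.range n, (1 - X ^ (s * (i + 1))) : k⟦X⟧) * invEuler k s n = 1 := by
  refine PowerSeries.mul_inv_cancel _ ?_
  rw [map_prod]
  refine Finset.prod_ne_zero_iff.mpr fun i _ => ?_
  have : s * (i + 1) ≠ 0 := by positivity
  simp [this]

theorem invEuler_zero (s : ℕ) : invEuler k s 0 = 1 := by simp [invEuler]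

theorem invEuler_succ {s : ℕ} (hs : 0 < s) (n : ℕ) :
    (1 - X ^ (s * (n + 1))) * invEuler k s (n + 1) = invEuler k s n := by
  have h1 := prod_mul_invEuler (k := k) hs n
  have h2 := prod_mul_invEuler (k := k) hs (n + 1)
  rw [Finset.prod_range_succ] at h2
  linear_combination (-(1 - X ^ (s * (n + 1))) * invEuler k s (n + 1)) * h1 + invEuler k s n * h2

theorem eq_of_forall_X_pow_dvd_sub {a b : k⟦X⟧} (h : ∀ n, X ^ n ∣ a - b) : a = b := by
  rw [← sub_eq_zero]
  ext n
  exact X_pow_dvd_iff.mp (h (n + 1)) n n.lt_succ_self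

/-! ### The character of order three -/

/-- `cos (2π (a - b) / 3)`. -/
def cosThird (k : Type*) [Field k] (a b : ℕ) : k := if a % 3 = b % 3 then 1 else -1 / 2

theorem cosThird_succ_succ (a b : ℕ) : cosThird k (a + 1) (b + 1) = cosThird k a b := by
  unfold cosThird
  congr 1
  simp only [eq_iff_iff]
  omega

theorem cosThird_succ_add [CharZero k] (a b : ℕ) :
    cosThird k (a + 1) b + cosThird k a (b + 1) = -cosThird k a b := by
  unfold cosThird
  split_ifs <;> first | omega | norm_num

/-- The coefficient of `z^n` in `1 / ((ωz;q)_∞ (ω⁻¹z;q)_∞)`, for `ω` a primitive third root of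
unity. -/
def rogersSzego (k : Type*) [Field k] (n : ℕ) : k⟦X⟧ :=
  ∑ p ∈ antidiagonal n, C (cosThird k p.1 p.2) * invEuler k 1 p.1 * invEuler k 1 p.2

theorem rogersSzego_zero : rogersSzego k 0 = 1 := by
  simp [rogersSzego, invEuler_zero, cosThird]

theorem rogersSzego_one [CharZero k] : (1 - X) * rogersSzego k 1 = -1 := by
  have h := invEuler_succ (k := k) one_pos 0
  rw [invEuler_zero] at h
  have e : (C (-1 / 2 : k) : k⟦X⟧) + C (-1 / 2 : k) = -1 := by
    rw [← map_add]; norm_num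
  simp only [rogersSzego, Finset.Nat.sum_antidiagonal_succ, Finset.Nat.antidiagonal_zero,
    Finset.sum_singleton, invEuler_zero, cosThird]
  norm_num at h e ⊢
  linear_combination e * (1 - X) * invEuler k 1 1 - h

theorem rogersSzego_add_two [CharZero k] (n : ℕ) :
    (1 - X ^ (n + 2)) * rogersSzego k (n + 2) = -rogersSzego k (n + 1) - rogersSzego k n := by
  have hP (a : ℕ) : (1 - X ^ (a + 1)) * invEuler k 1 (a + 1) = invEuler k 1 a := by
    simpa using invEuler_succ (k := k) one_pos a
  -- With a + b = n + 2, use 1 - q^{a+b} = (1 - q^a) + (1 - q^b) - (1 - q^a)(1 - q^b). Each factor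
  -- lowers an index, and 1 + ω + ω⁻¹ = 0 merges the first two sums.
  have key : ∀ p ∈ antidiagonal (n + 2),
      (1 - X ^ (n + 2)) * (C (cosThird k p.1 p.2) * invEuler k 1 p.1 * invEuler k 1 p.2) =
      C (cosThird k p.1 p.2) * ((1 - X ^ p.1) * invEuler k 1 p.1) * invEuler k 1 p.2 +
      C (cosThird k p.1 p.2) * invEuler k 1 p.1 * ((1 - X ^ p.2) * invEuler k 1 p.2) -
      C (cosThird k p.1 p.2) * ((1 - X ^ p.1) * invEuler k 1 p.1) *
        ((1 - X ^ p.2) * invEuler k 1 p.2) := by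
    intro p hp
    rw [← mem_antidiagonal.mp hp, pow_add]
    ring
  have h1 : ∑ p ∈ antidiagonal (n + 2),
      C (cosThird k p.1 p.2) * ((1 - X ^ p.1) * invEuler k 1 p.1) * invEuler k 1 p.2 =
      ∑ p ∈ antidiagonal (n + 1),
        C (cosThird k (p.1 + 1) p.2) * invEuler k 1 p.1 * invEuler k 1 p.2 := by
    rw [Finset.Nat.sum_antidiagonal_succ]
    simp only [hP, pow_zero, sub_self, zero_mul, mul_zero, zero_add]
  have h2 : ∑ p ∈ antidiagonal (n + 2),
      C (cosThird k p.1 p.2) * invEuler k 1 p.1 * ((1 - X ^ p.2) * invEuler k 1 p.2) =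
      ∑ p ∈ antidiagonal (n + 1),
        C (cosThird k p.1 (p.2 + 1)) * invEuler k 1 p.1 * invEuler k 1 p.2 := by
    rw [Finset.Nat.sum_antidiagonal_succ']
    simp only [hP, pow_zero, sub_self, zero_mul, mul_zero, zero_add]
  have h3 : ∑ p ∈ antidiagonal (n + 2), C (cosThird k p.1 p.2) *
      ((1 - X ^ p.1) * invEuler k 1 p.1) * ((1 - X ^ p.2) * invEuler k 1 p.2) =
      rogersSzego k n := by
    rw [Finset.Nat.sum_antidiagonal_succ, Finset.Nat.sum_antidiagonal_succ', rogersSzego]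
    simp only [hP, pow_zero, sub_self, zero_mul, mul_zero, zero_add, cosThird_succ_succ]
  rw [rogersSzego, Finset.mul_sum, Finset.sum_congr rfl key, Finset.sum_sub_distrib,
    Finset.sum_add_distrib, h1, h2, h3, ← Finset.sum_add_distrib, rogersSzego, rogersSzego,
    ← Finset.sum_neg_distrib]
  congr 1
  refine Finset.sum_congr rfl fun p _ => ?_
  have := congrArg C (cosThird_succ_add (k := k) p.1 p.2)
  rw [map_add, map_neg] at this
  linear_combination invEuler k 1 p.1 * invEuler k 1 p.2 * this

theorem sum_range_two_mul_add_one_of_symm {M : Type*} [AddCommMonoid M] (h : ℕ → M) (n : ℕ)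
    (hs : ∀ j ≤ n, h (n - j) = h (n + j)) :
    ∑ a ∈ Finset.range (2 * n + 1), h a =
      h n + ∑ j ∈ Finset.range n, (h (n + (j + 1)) + h (n + (j + 1))) := by
  rw [show 2 * n + 1 = n + (n + 1) by ring, Finset.sum_range_add, Finset.sum_range_succ',
    ← Finset.sum_range_reflect, Finset.sum_add_distrib, add_zero,
    add_comm (∑ j ∈ Finset.range n, h (n + (j + 1))), ← add_assoc, add_comm _ (h n), add_assoc]
  congr 2
  refine Finset.sum_congr rfl fun j hj => ?_
  have := Finset.mem_range.mp hj
  rw [← hs (j + 1) (by omega)]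
  congr 1
  omega

/-- `1` at zero, `2 cos (2π j / 3)` at `j > 0`. -/
def thetaCoeff (k : Type*) [Field k] (j : ℕ) : k :=
  if j = 0 then 1 else if j % 3 = 0 then 2 else -1

/-- Folding the convolution about its midpoint pairs the indices (n+j, n-j) and (n-j, n+j). Their
character is ω^{2j}, whose real part equals that of ω^j. This is the Bailey-pair form of R_{2n}. -/
theorem rogersSzego_two_mul [CharZero k] (n : ℕ) :
    rogersSzego k (2 * n) = ∑ p ∈ antidiagonal n,
      C (thetaCoeff k p.1) * invEuler k 1 p.2 * invEuler k 1 (p.2 + 2 * p.1) := by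
  rw [rogersSzego, Finset.Nat.sum_antidiagonal_eq_sum_range_succ
    (fun a b => C (cosThird k a b) * invEuler k 1 a * invEuler k 1 b),
    sum_range_two_mul_add_one_of_symm, Finset.Nat.sum_antidiagonal_eq_sum_range_succ
    (fun a b => C (thetaCoeff k a) * invEuler k 1 b * invEuler k 1 (b + 2 * a)),
    Nat.succ_eq_add_one, Finset.sum_range_succ', add_comm]
  · congr 1
    · refine Finset.sum_congr rfl fun j hj => ?_
      have hj' := Finset.mem_range.mp hj
      rw [show 2 * n - (n + (j + 1)) = n - (j + 1) by omega,
        show n - (j + 1) + 2 * (j + 1) = n + (j + 1) by omega]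
      have : thetaCoeff k (j + 1) =
          cosThird k (n + (j + 1)) (n - (j + 1)) + cosThird k (n + (j + 1)) (n - (j + 1)) := by
        unfold thetaCoeff cosThird
        split_ifs <;> first | contradiction | omega | norm_num
      rw [this, map_add]
      ring
    · simp [thetaCoeff, cosThird, show 2 * n - n = n by omega]
  · intro j hj
    rw [show 2 * n - (n - j) = n + j by omega, show 2 * n - (n + j) = n - j by omega]
    have : cosThird k (n - j) (n + j) = cosThird k (n + j) (n - j) := by
      unfold cosThird
      simp only [eq_comm]
    rw [this]
    ring

/-! ### A finite form of the triple product at a third root of unity -/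

/-- The sequence `1, -2, 1, 1, -2, 1, …` of period three. -/
def tripleCoeff (k : Type*) [Field k] (j : ℕ) : k := if j % 3 = 1 then -2 else 1

/-- The summand of the finite triple product, extended by zero. -/
def tripleTerm (k : Type*) [Field k] (s n j : ℕ) : k⟦X⟧ :=
  if j ≤ n then X ^ (s * (j * (j + 1) / 2)) * invEuler k s (n - j) * invEuler k s (n + 1 + j)
  else 0

theorem tripleCoeff_add_add (j : ℕ) :
    tripleCoeff k j + tripleCoeff k (j + 1) + tripleCoeff k (j + 2) = 0 := by
  unfold tripleCoeff
  split_ifs <;> first | omega | norm_num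

theorem triangle_succ (j : ℕ) : (j + 1) * (j + 1 + 1) / 2 = j * (j + 1) / 2 + (j + 1) := by
  rw [← Nat.add_mul_div_right _ _ (by norm_num : 0 < 2)]
  congr 1
  ring

theorem tripleTerm_zero_succ {s : ℕ} (hs : 0 < s) (n : ℕ) :
    (1 - X ^ (s * (2 * n + 2))) * (1 - X ^ (s * (2 * n + 3))) * tripleTerm k s (n + 1) 0 =
      (1 + X ^ (s * (2 * n + 2))) * tripleTerm k s n 0 +
        X ^ (s * (n + 1)) * (tripleTerm k s n 0 + tripleTerm k s n 1) := by
  have h1 := invEuler_succ (k := k) hs n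
  have h2 := invEuler_succ (k := k) hs (n + 1)
  have h3 : tripleTerm k s n 1 = X ^ s * (1 - X ^ (s * n)) * invEuler k s n *
      invEuler k s (n + 2) := by
    unfold tripleTerm
    rcases n with _ | n
    · simp
    · rw [if_pos (by omega), show n + 1 - 1 = n by omega, ← invEuler_succ hs n]
      rw [show 1 * (1 + 1) / 2 = 1 by rfl, mul_one]
      ring
  have h0 (m : ℕ) : tripleTerm k s m 0 = invEuler k s m * invEuler k s (m + 1) := by
    simp [tripleTerm]
  rw [h3, h0, h0, ← h1, show n + 1 + 1 = n + 2 by ring]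
  rw [show n + 1 + 1 = n + 2 by ring] at h2
  rw [← h2]
  simp only [pow_mul]
  ring

theorem tripleTerm_succ_succ {s : ℕ} (hs : 0 < s) (n j : ℕ) (hj : j ≤ n) :
    (1 - X ^ (s * (2 * n + 2))) * (1 - X ^ (s * (2 * n + 3))) * tripleTerm k s (n + 1) (j + 1) =
      (1 + X ^ (s * (2 * n + 2))) * tripleTerm k s n (j + 1) +
        X ^ (s * (n + 1)) * (tripleTerm k s n j + tripleTerm k s n (j + 2)) := by
  obtain ⟨d, rfl⟩ := Nat.exists_eq_add_of_le hj
  have hQ1 := invEuler_succ (k := k) hs (2 * j + d + 1)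
  have hQ2 := invEuler_succ (k := k) hs (2 * j + d + 2)
  have h3 : tripleTerm k s (j + d + 1) (j + 1) = X ^ (s * (j * (j + 1) / 2 + (j + 1))) *
      invEuler k s d * invEuler k s (2 * j + d + 3) := by
    rw [tripleTerm, if_pos (by omega), triangle_succ, show j + d + 1 - (j + 1) = d by omega,
      show j + d + 1 + 1 + (j + 1) = 2 * j + d + 3 by omega]
  have h0 : tripleTerm k s (j + d) j = X ^ (s * (j * (j + 1) / 2)) *
      invEuler k s d * invEuler k s (2 * j + d + 1) := by
    rw [tripleTerm, if_pos (by omega), show j + d - j = d by omega,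
      show j + d + 1 + j = 2 * j + d + 1 by omega]
  -- Keeping 1 - X^{sd} explicit makes the formula valid at d = 0 too, where the term is zero by
  -- truncation. The same device covers `h2` below.
  have h1 : tripleTerm k s (j + d) (j + 1) = X ^ (s * (j * (j + 1) / 2 + (j + 1))) *
      ((1 - X ^ (s * d)) * invEuler k s d) * invEuler k s (2 * j + d + 2) := by
    rcases d with _ | d
    · simp [tripleTerm]
    · rw [tripleTerm, if_pos (by omega), invEuler_succ hs, triangle_succ,
        show j + (d + 1) - (j + 1) = d by omega,
        show j + (d + 1) + 1 + (j + 1) = 2 * j + (d + 1) + 2 by omega]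
  rw [h3, h0, h1, ← hQ1, ← hQ2]
  rcases d with _ | d
  · have h2 : tripleTerm k s (j + 0) (j + 2) = 0 := by simp [tripleTerm]
    rw [h2]
    simp only [pow_mul]
    ring
  · have h2 : tripleTerm k s (j + (d + 1)) (j + 2) =
        X ^ (s * (j * (j + 1) / 2 + (j + 1) + (j + 2))) *
        ((1 - X ^ (s * d)) * ((1 - X ^ (s * (d + 1))) * invEuler k s (d + 1))) *
          invEuler k s (2 * j + d + 4) := by
      rcases d with _ | d
      · simp [tripleTerm]
      · rw [tripleTerm, if_pos (by omega), invEuler_succ hs, invEuler_succ hs, triangle_succ,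
          triangle_succ, show j + (d + 1 + 1) - (j + 2) = d by omega,
          show j + (d + 1 + 1) + 1 + (j + 2) = 2 * j + (d + 1) + 4 by omega]
    rw [h2, show 2 * j + (d + 1) + 2 + 1 = 2 * j + d + 4 by ring]
    simp only [pow_mul]
    ring

/-- The terms at level n+1 are a three-term stencil of those at level n, reflected at j = 0. Since
t_{j-1} + t_j + t_{j+1} = 0, the neighbour sum acts on t as multiplication by -1, which yields the
factor 1 - Q^{n+1} + Q^{2n+2} with Q = X^s. -/
theorem sum_tripleTerm_succ {s : ℕ} (hs : 0 < s) (n : ℕ) :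
    (1 - X ^ (s * (2 * n + 2))) * (1 - X ^ (s * (2 * n + 3))) *
        ∑ j ∈ Finset.range (n + 2), C (tripleCoeff k j) * tripleTerm k s (n + 1) j =
      (1 - X ^ (s * (n + 1)) + X ^ (s * (2 * n + 2))) *
        ∑ j ∈ Finset.range (n + 1), C (tripleCoeff k j) * tripleTerm k s n j := by
  have z1 : tripleTerm k s n (n + 1) = 0 := by simp [tripleTerm]
  have z2 : tripleTerm k s n (n + 2) = 0 := by simp [tripleTerm]
  have c0 : (C (tripleCoeff k 0) : k⟦X⟧) = 1 := by simp [tripleCoeff]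
  have c1 : (C (tripleCoeff k 1) : k⟦X⟧) = -2 := by
    rw [tripleCoeff, if_pos rfl, map_neg]
    rfl
  have c (j : ℕ) : (C (tripleCoeff k j) : k⟦X⟧) + C (tripleCoeff k (j + 1)) +
      C (tripleCoeff k (j + 2)) = 0 := by
    rw [← map_add, ← map_add, tripleCoeff_add_add, map_zero]
  set t := tripleTerm k s n with ht
  -- summation by parts for the three shifts of `t`
  have A : ∑ j ∈ Finset.range (n + 1), C (tripleCoeff k j) * t j =
      t 0 + ∑ j ∈ Finset.range (n + 1), C (tripleCoeff k (j + 1)) * t (j + 1) := by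
    have := Finset.sum_range_succ' (fun j => C (tripleCoeff k j) * t j) (n + 1)
    rw [Finset.sum_range_succ, z1, mul_zero, add_zero, c0, one_mul] at this
    rw [this, add_comm]
  have B : ∑ j ∈ Finset.range (n + 1), C (tripleCoeff k (j + 1)) * t j =
      -2 * t 0 + ∑ j ∈ Finset.range (n + 1), C (tripleCoeff k (j + 2)) * t (j + 1) := by
    have := Finset.sum_range_succ' (fun j => C (tripleCoeff k (j + 1)) * t j) (n + 1)
    rw [Finset.sum_range_succ, z1, mul_zero, add_zero, zero_add, c1] at this
    rw [this, add_comm]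
  have D : ∑ j ∈ Finset.range (n + 1), C (tripleCoeff k j) * t (j + 1) =
      t 1 + ∑ j ∈ Finset.range (n + 1), C (tripleCoeff k (j + 1)) * t (j + 2) := by
    have := Finset.sum_range_succ' (fun j => C (tripleCoeff k j) * t (j + 1)) (n + 1)
    rw [Finset.sum_range_succ, z2, mul_zero, add_zero, zero_add, c0, one_mul] at this
    rw [this, add_comm]
  have E : ∑ j ∈ Finset.range (n + 1), C (tripleCoeff k j) * t (j + 1) +
      ∑ j ∈ Finset.range (n + 1), C (tripleCoeff k (j + 1)) * t (j + 1) +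
      ∑ j ∈ Finset.range (n + 1), C (tripleCoeff k (j + 2)) * t (j + 1) = 0 := by
    rw [← Finset.sum_add_distrib, ← Finset.sum_add_distrib]
    refine Finset.sum_eq_zero fun j _ => ?_
    rw [← add_mul, ← add_mul, c, zero_mul]
  have F : (1 - X ^ (s * (2 * n + 2))) * (1 - X ^ (s * (2 * n + 3))) *
        ∑ j ∈ Finset.range (n + 1), C (tripleCoeff k (j + 1)) * tripleTerm k s (n + 1) (j + 1) =
      (1 + X ^ (s * (2 * n + 2))) *
          ∑ j ∈ Finset.range (n + 1), C (tripleCoeff k (j + 1)) * t (j + 1) +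
        X ^ (s * (n + 1)) * (∑ j ∈ Finset.range (n + 1), C (tripleCoeff k (j + 1)) * t j +
          ∑ j ∈ Finset.range (n + 1), C (tripleCoeff k (j + 1)) * t (j + 2)) := by
    rw [Finset.mul_sum, ← Finset.sum_add_distrib, Finset.mul_sum, Finset.mul_sum,
      ← Finset.sum_add_distrib]
    refine Finset.sum_congr rfl fun j hj => ?_
    have hj' : j ≤ n := by simpa [Nat.lt_succ_iff] using hj
    linear_combination (C (tripleCoeff k (j + 1)) : k⟦X⟧) * tripleTerm_succ_succ (k := k) hs n j hj'
  rw [Finset.sum_range_succ', c0]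
  linear_combination F + tripleTerm_zero_succ (k := k) hs n +
    X ^ (s * (n + 1)) * (B - D + E) + (-1 - X ^ (s * (2 * n + 2)) + X ^ (s * (n + 1))) * A

/-- The finite triple product at a primitive third root of unity. -/
theorem sum_tripleTerm {s : ℕ} (hs : 0 < s) (n : ℕ) :
    ∑ j ∈ Finset.range (n + 1), C (tripleCoeff k j) * tripleTerm k s n j =
      (∏ i ∈ Finset.range n, (1 - X ^ (s * (i + 1)) + X ^ (s * (2 * i + 2)))) *
        invEuler k s (2 * n + 1) := by
  induction n with
  | zero => simp [tripleTerm, tripleCoeff, invEuler_zero (k := k)]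
  | succ n ih =>
    have ne (m : ℕ) : (1 - X ^ (s * (m + 1)) : k⟦X⟧) ≠ 0 := by
      intro h
      have := congrArg constantCoeff h
      simp [hs.ne'] at this
    refine mul_left_cancel₀ (mul_ne_zero (ne (2 * n + 1)) (ne (2 * n + 2))) ?_
    rw [sum_tripleTerm_succ hs, ih, Finset.prod_range_succ,
      ← invEuler_succ (k := k) hs (2 * n + 1), ← invEuler_succ (k := k) hs (2 * n + 2)]
    ring_nf

end PowerSeriesIdentities

/-! ### Passage to the limit and evaluation of ∑ q^{n(n-1)} R_{2n}. -/

noncomputable section PowerSeriesLimits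

open PowerSeries Filter
open Finset.HasAntidiagonal (antidiagonal mem_antidiagonal)
open scoped PowerSeries.WithPiTopology Topology

variable {k : Type*} [Field k]

theorem hasSum_of_eq {M ι : Type*} [AddCommMonoid M] [TopologicalSpace M] {f g : ι → M} {a b : M}
    (h : HasSum f a) (hfg : ∀ i, g i = f i) (hab : b = a) : HasSum g b := by
  rwa [hab, funext hfg]

theorem thetaCoeff_add (j : ℕ) : (if j = 0 then 1 else 0) + thetaCoeff k j + thetaCoeff k (j + 1) =
    tripleCoeff k j := by
  unfold thetaCoeff tripleCoeff
  split_ifs <;> first | contradiction | omega | norm_num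

theorem X_pow_dvd_prod_sub_one {ι : Type*} {f : ι → k⟦X⟧} (n : ℕ) (s : Finset ι)
    (hs : ∀ i ∈ s, X ^ n ∣ f i - 1) : X ^ n ∣ ∏ i ∈ s, f i - 1 := by
  classical
  induction s using Finset.induction_on with
  | empty => simp
  | insert a s ha ih =>
    rw [Finset.prod_insert ha, show f a * ∏ i ∈ s, f i - 1 =
      (f a - 1) * ∏ i ∈ s, f i + (∏ i ∈ s, f i - 1) by ring]
    exact dvd_add (Dvd.dvd.mul_right (hs a (Finset.mem_insert_self a s)) _)
      (ih fun i hi => hs i (Finset.mem_insert_of_mem hi))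

variable [TopologicalSpace k]

theorem summable_of_finite_not_X_pow_dvd {ι : Type*} {f : ι → k⟦X⟧}
    (h : ∀ n, {i | ¬X ^ n ∣ f i}.Finite) : Summable f := by
  rw [WithPiTopology.summable_iff_summable_coeff]
  intro n
  refine summable_of_hasFiniteSupport ((h (n + 1)).subset fun i hi hd => hi ?_)
  exact X_pow_dvd_iff.mp hd n n.lt_succ_self

/-! ### Durfee-type sums -/

def durfeeTerm (k : Type*) [Field k] (m n : ℕ) : k⟦X⟧ :=
  X ^ (n * n + m * n) * invEuler k 1 n * invEuler k 1 (n + m)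

def durfeeSum (k : Type*) [Field k] [TopologicalSpace k] (m : ℕ) : k⟦X⟧ :=
  ∑' n, durfeeTerm k m n

theorem hasSum_durfeeTerm (m : ℕ) : HasSum (durfeeTerm k m) (durfeeSum k m) := by
  refine Summable.hasSum (summable_of_finite_not_X_pow_dvd fun n => ?_)
  refine (Set.finite_Iio n).subset fun i hi => ?_
  by_contra hin
  refine hi (Dvd.dvd.mul_right (Dvd.dvd.mul_right (pow_dvd_pow X ?_) _) _)
  have : n ≤ i := by simpa using hin
  nlinarith

variable [DiscreteTopology k]

theorem X_pow_dvd_of_tendsto {ι : Type*} {l : Filter ι} [l.NeBot] {f : ι → k⟦X⟧} {a : k⟦X⟧}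
    (n : ℕ) (h : Tendsto f l (𝓝 a)) (hf : ∀ᶠ i in l, X ^ n ∣ f i) : X ^ n ∣ a := by
  refine X_pow_dvd_iff.mpr fun m hm => ?_
  have h1 := ((WithPiTopology.continuous_coeff k m).tendsto a).comp h
  refine tendsto_nhds_unique h1 (tendsto_const_nhds.congr' ?_)
  filter_upwards [hf] with i hi
  exact (X_pow_dvd_iff.mp hi m hm).symm

theorem X_pow_dvd_hasSum_sub {ι : Type*} {f : ι → k⟦X⟧} {a : k⟦X⟧} (h : HasSum f a) (n : ℕ)
    (s : Finset ι) (hs : ∀ i ∉ s, X ^ n ∣ f i) : X ^ n ∣ a - ∑ i ∈ s, f i := by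
  have h' : Tendsto (fun t => ∑ i ∈ t, f i - ∑ i ∈ s, f i) atTop (𝓝 (a - ∑ i ∈ s, f i)) :=
    Tendsto.sub_const h _
  refine X_pow_dvd_of_tendsto n h' ?_
  filter_upwards [eventually_ge_atTop s] with t ht
  classical
  rw [← Finset.sum_sdiff ht, add_sub_cancel_right]
  exact Finset.dvd_sum fun i hi => hs i (Finset.mem_sdiff.mp hi).2

theorem X_pow_dvd_hasProd_sub {ι : Type*} {f : ι → k⟦X⟧} {a : k⟦X⟧} (h : HasProd f a) (n : ℕ)
    (s : Finset ι) (hs : ∀ i ∉ s, X ^ n ∣ f i - 1) : X ^ n ∣ a - ∏ i ∈ s, f i := by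
  have h' : Tendsto (fun t => ∏ i ∈ t, f i - ∏ i ∈ s, f i) atTop (𝓝 (a - ∏ i ∈ s, f i)) :=
    Tendsto.sub_const h _
  refine X_pow_dvd_of_tendsto n h' ?_
  filter_upwards [eventually_ge_atTop s] with t ht
  classical
  rw [← Finset.prod_sdiff ht, ← sub_one_mul]
  exact Dvd.dvd.mul_right
    (X_pow_dvd_prod_sub_one n _ fun i hi => hs i (Finset.mem_sdiff.mp hi).2) _

theorem X_pow_dvd_mul_invEuler_sub_one {s : ℕ} (hs : 0 < s) {A : k⟦X⟧}
    (hA : HasProd (fun i => 1 - X ^ (s * (i + 1))) A) (n : ℕ) :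
    X ^ n ∣ A * invEuler k s n - 1 := by
  have h := X_pow_dvd_hasProd_sub hA n (Finset.range n) fun i hi => by
    have hi' : n ≤ i := by simpa using hi
    rw [sub_sub_cancel_left, dvd_neg]
    exact pow_dvd_pow X (by nlinarith)
  rw [← prod_mul_invEuler hs n, ← sub_mul]
  exact h.mul_right _

/-- This contiguous relation can be iterated: each use gains a factor X^{m+1}, hence at least one X,
so consecutive sums differ by something divisible by every power of X. Thus `durfeeSum` does not
depend on m. -/
theorem durfeeSum_sub_durfeeSum (m : ℕ) : durfeeSum k m - durfeeSum k (m + 1) =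
    X ^ (m + 1) * (durfeeSum k (m + 2) - durfeeSum k (m + 1)) := by
  have hP (a : ℕ) : (1 - X ^ (a + 1)) * invEuler k 1 (a + 1) = invEuler k 1 a := by
    simpa using invEuler_succ (k := k) one_pos a
  have h1 := (hasSum_durfeeTerm (k := k) m).sub (hasSum_durfeeTerm (m + 1))
  have h2 := (hasSum_durfeeTerm (k := k) (m + 1)).mul_left (X ^ (m + 1))
  have h3 := (hasSum_durfeeTerm (k := k) (m + 2)).mul_left (X ^ (m + 1))
  have h4 : HasSum (fun n => durfeeTerm k m n - durfeeTerm k (m + 1) n +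
      X ^ (m + 1) * durfeeTerm k (m + 1) n) (X ^ (m + 1) * durfeeSum k (m + 2)) := by
    rw [← hasSum_nat_add_iff' 1, Finset.sum_range_one]
    have e0 : durfeeTerm k m 0 - durfeeTerm k (m + 1) 0 +
        X ^ (m + 1) * durfeeTerm k (m + 1) 0 = 0 := by
      simp only [durfeeTerm, mul_zero, pow_zero, zero_add, add_zero, ← hP m]
      ring
    rw [e0, sub_zero]
    refine hasSum_of_eq h3 (fun n => ?_) rfl
    simp only [durfeeTerm]
    rw [← hP n, show n + 1 + m = n + m + 1 by ring, ← hP (n + m + 1), ← hP (n + m + 2),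
      show n + 1 + (m + 1) = n + m + 2 by ring, ← hP (n + m + 2),
      show n + (m + 2) = n + m + 2 by ring, ← hP (n + m + 2)]
    ring
  have h5 := (h1.add h2).unique h4
  linear_combination h5

theorem durfeeSum_eq (m : ℕ) : durfeeSum k m = durfeeSum k 0 := by
  have key (n : ℕ) : ∀ m, X ^ n ∣ durfeeSum k m - durfeeSum k (m + 1) := by
    induction n with
    | zero => simp
    | succ n ih =>
      intro m
      rw [durfeeSum_sub_durfeeSum, pow_succ', pow_succ', mul_assoc]
      refine mul_dvd_mul_left X (Dvd.dvd.mul_left ?_ _)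
      rw [dvd_sub_comm]
      exact ih (m + 1)
  induction m with
  | zero => rfl
  | succ m ih => rw [← ih, eq_of_forall_X_pow_dvd_sub fun n => key n m]

theorem durfeeSum_mul {A : k⟦X⟧} (hA : HasProd (fun i => 1 - X ^ (i + 1)) A) (m : ℕ) :
    A * durfeeSum k m = 1 := by
  rw [durfeeSum_eq]
  refine eq_of_forall_X_pow_dvd_sub fun n => ?_
  have hA' : HasProd (fun i => 1 - X ^ (1 * (i + 1))) A := by simpa using hA
  have h1 := X_pow_dvd_mul_invEuler_sub_one one_pos hA' n
  -- By independence of m, take m = n: modulo X^n only the zeroth term 1/(q)_n survives.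
  have h2 := X_pow_dvd_hasSum_sub (hasSum_durfeeTerm (k := k) n) n (Finset.range 1) fun i hi => by
    have hi' : 1 ≤ i := by simpa [Nat.one_le_iff_ne_zero] using hi
    refine Dvd.dvd.mul_right (Dvd.dvd.mul_right (pow_dvd_pow X ?_) _) _
    nlinarith
  rw [Finset.sum_range_one, durfeeSum_eq] at h2
  simp only [durfeeTerm, mul_zero, add_zero, pow_zero, one_mul, zero_add, invEuler_zero] at h2
  rw [show A * durfeeSum k 0 - 1 = A * (durfeeSum k 0 - invEuler k 1 n) +
    (A * invEuler k 1 n - 1) by ring]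
  exact dvd_add (h2.mul_left _) h1

/-- Write q^{n(n-1)} = q^{n²} + q^{n(n-1)}(1 - q^n). The second piece cancels a factor of (q)_n and,
after a shift of n, is a Durfee sum with m+1. -/
theorem hasSum_shifted_durfee (m : ℕ) :
    HasSum (fun n => X ^ (n * (n - 1) + m * n) * invEuler k 1 n * invEuler k 1 (n + m))
      (durfeeSum k m + X ^ m * durfeeSum k (m + 1)) := by
  have hP (a : ℕ) : (1 - X ^ (a + 1)) * invEuler k 1 (a + 1) = invEuler k 1 a := by
    simpa using invEuler_succ (k := k) one_pos a
  have h1 : HasSum (fun n => X ^ (n * (n - 1) + m * n) * (1 - X ^ n) * invEuler k 1 n *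
      invEuler k 1 (n + m)) (X ^ m * durfeeSum k (m + 1)) := by
    rw [← hasSum_nat_add_iff' 1, Finset.sum_range_one, pow_zero, sub_self, mul_zero, zero_mul,
      zero_mul, sub_zero]
    refine hasSum_of_eq ((hasSum_durfeeTerm (k := k) (m + 1)).mul_left (X ^ m)) (fun n => ?_) rfl
    simp only [durfeeTerm]
    rw [← hP n, Nat.add_sub_cancel, show n + 1 + m = n + (m + 1) by ring]
    ring
  refine hasSum_of_eq ((hasSum_durfeeTerm (k := k) m).add h1) (fun n => ?_) rfl
  simp only [durfeeTerm]
  rcases n with _ | n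
  · simp
  · rw [Nat.add_sub_cancel]
    ring

/-! ### The theta series -/

/-- The triple product identity at a primitive third root of unity. -/
theorem hasSum_tripleCoeff_eq {s : ℕ} (hs : 0 < s) {S B D : k⟦X⟧}
    (hS : HasSum (fun j => C (tripleCoeff k j) * X ^ (s * (j * (j + 1) / 2))) S)
    (hB : HasProd (fun i => 1 - X ^ (s * (i + 1))) B)
    (hD : HasProd (fun i => 1 - X ^ (s * (i + 1)) + X ^ (s * (2 * i + 2))) D) : S = B * D := by
  refine eq_of_forall_X_pow_dvd_sub fun n => ?_
  have tri (j : ℕ) : j ≤ j * (j + 1) / 2 := by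
    rw [Nat.le_div_iff_mul_le (by norm_num)]
    nlinarith [Nat.le_mul_self j]
  have hle {m l : ℕ} (h : m ≤ l) : (X ^ m : k⟦X⟧) ∣ X ^ l := pow_dvd_pow X h
  have h1 := X_pow_dvd_hasSum_sub hS n (Finset.range (n + 1)) fun j hj => by
    have hj' : n + 1 ≤ j := by simpa using hj
    refine Dvd.dvd.mul_left (hle ?_) _
    have := tri j
    nlinarith
  have h2 := X_pow_dvd_hasProd_sub hD n (Finset.range n) fun i hi => by
    have hi' : n ≤ i := by simpa using hi
    rw [sub_add_eq_add_sub, add_sub_assoc, add_sub_cancel_left]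
    exact dvd_sub (hle (by nlinarith)) (hle (by nlinarith))
  have hB1 (m : ℕ) := X_pow_dvd_mul_invEuler_sub_one hs hB m
  have h3 : X ^ n ∣ B ^ 2 * (∑ j ∈ Finset.range (n + 1), C (tripleCoeff k j) * tripleTerm k s n j) -
      ∑ j ∈ Finset.range (n + 1), C (tripleCoeff k j) * X ^ (s * (j * (j + 1) / 2)) := by
    rw [Finset.mul_sum, ← Finset.sum_sub_distrib]
    refine Finset.dvd_sum fun j hj => ?_
    have hj' : j ≤ n := by simpa [Nat.lt_succ_iff] using hj
    rw [tripleTerm, if_pos hj']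
    -- The Euler factor of index n - j is accurate only modulo X^{n-j}; the missing X^j comes from
    -- the triangular exponent, which is at least j.
    have a1 : X ^ n ∣ X ^ (s * (j * (j + 1) / 2)) * (B * invEuler k s (n - j) - 1) := by
      refine (hle ?_ : X ^ n ∣ X ^ (s * (j * (j + 1) / 2) + (n - j))).trans ?_
      · have := tri j
        have : j * (j + 1) / 2 ≤ s * (j * (j + 1) / 2) := Nat.le_mul_of_pos_left _ hs
        omega
      · rw [pow_add]
        exact mul_dvd_mul_left _ (hB1 _)
    have a2 : X ^ n ∣ B * invEuler k s (n + 1 + j) - 1 := (hle (by omega)).trans (hB1 _)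
    have := dvd_add (a1.mul_right (B * invEuler k s (n + 1 + j)))
      (a2.mul_left (X ^ (s * (j * (j + 1) / 2))))
    convert this.mul_left (C (tripleCoeff k j)) using 1
    ring
  rw [sum_tripleTerm hs] at h3
  have h4 : X ^ n ∣ B * invEuler k s (2 * n + 1) - 1 := (hle (by omega)).trans (hB1 _)
  set T := ∑ j ∈ Finset.range (n + 1), C (tripleCoeff k j) * X ^ (s * (j * (j + 1) / 2))
  set E := ∏ i ∈ Finset.range n, (1 - X ^ (s * (i + 1)) + X ^ (s * (2 * i + 2)) : k⟦X⟧)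
  have := dvd_add (dvd_sub (dvd_sub h1 h3) (h2.mul_left B)) (h4.mul_left (B * E))
  convert this using 1
  ring

/-! ### The Bailey-type double sum -/

/-- Insert the Bailey form of R_{2n} and sum over n first. The exponent splits as j(j-1) + n(n-1) +
2jn, so the inner sum is a shifted Durfee sum and equals (q^{j(j-1)} + q^{j(j+1)})/(q)_∞. -/
theorem hasSum_rogersSzego [CharZero k] {A B D : k⟦X⟧}
    (hA : HasProd (fun i => 1 - X ^ (i + 1)) A)
    (hB : HasProd (fun i => 1 - X ^ (2 * (i + 1))) B)
    (hD : HasProd (fun i => 1 - X ^ (2 * (i + 1)) + X ^ (2 * (2 * i + 2))) D) :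
    ∃ S, HasSum (fun n => X ^ (n * (n - 1)) * rogersSzego k (2 * n)) S ∧ A * S = B * D := by
  set g : ℕ × ℕ → k⟦X⟧ := fun p => C (thetaCoeff k p.1) * X ^ ((p.1 + p.2) * (p.1 + p.2 - 1)) *
    invEuler k 1 p.2 * invEuler k 1 (p.2 + 2 * p.1) with hg
  have hgs : Summable g := by
    refine summable_of_finite_not_X_pow_dvd fun n => ?_
    refine ((Set.finite_Iio (n + 2)).prod (Set.finite_Iio (n + 2))).subset fun p hp => ?_
    by_contra hpn
    refine hp (Dvd.dvd.mul_right (Dvd.dvd.mul_right (Dvd.dvd.mul_left (pow_dvd_pow X ?_) _) _) _)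
    have h1 : n + 2 ≤ p.1 + p.2 := by
      simp only [Set.mem_prod, Set.mem_Iio] at hpn
      omega
    obtain ⟨d, hd⟩ := Nat.exists_eq_add_of_le h1
    rw [hd, show n + 2 + d - 1 = n + 1 + d by omega]
    nlinarith
  obtain ⟨S, hS⟩ := hgs
  refine ⟨S, ?_, ?_⟩
  · have h1 := (Finset.HasAntidiagonal.sigmaAntidiagonalEquivProd (A := ℕ)).hasSum_iff.mpr hS
    refine (h1.sigma (g := fun n => X ^ (n * (n - 1)) * rogersSzego k (2 * n)) fun n => ?_)
    have h2 := hasSum_fintype fun p : antidiagonal n => g p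
    refine hasSum_of_eq h2 (fun p => rfl) ?_
    rw [rogersSzego_two_mul, Finset.mul_sum, Finset.sum_coe_sort (antidiagonal n) g]
    refine Finset.sum_congr rfl fun p hp => ?_
    rw [hg, ← mem_antidiagonal.mp hp]
    ring
  · have h1 := hS.prod_fiberwise (g := fun j => C (thetaCoeff k j) *
      (X ^ (j * (j - 1)) + X ^ (j * (j + 1))) * durfeeSum k 0) fun j => by
        refine hasSum_of_eq ((hasSum_shifted_durfee (k := k) (2 * j)).mul_left
          (C (thetaCoeff k j) * X ^ (j * (j - 1)))) (fun n => ?_) ?_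
        · have e : (j + n) * (j + n - 1) = j * (j - 1) + (n * (n - 1) + 2 * j * n) := by
            rcases j with _ | j
            · simp
            · rcases n with _ | n
              · simp
              · rw [show j + 1 + (n + 1) - 1 = j + n + 1 by omega, Nat.add_sub_cancel,
                  Nat.add_sub_cancel]
                ring
          rw [hg]
          dsimp only
          rw [e, pow_add]
          ring
        · have e : j * (j + 1) = j * (j - 1) + 2 * j := by
            rcases j with _ | j
            · simp
            · rw [Nat.add_sub_cancel]
              ring
          rw [durfeeSum_eq (2 * j), durfeeSum_eq (2 * j + 1), e, pow_add]
          ring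
    have h2 := h1.mul_left A
    have h3 : HasSum (fun j => C (thetaCoeff k j) * X ^ (j * (j - 1)) +
        C (thetaCoeff k j) * X ^ (j * (j + 1))) (A * S) := by
      refine hasSum_of_eq h2 (fun j => ?_) rfl
      linear_combination -(C (thetaCoeff k j) * (X ^ (j * (j - 1)) + X ^ (j * (j + 1)))) *
        durfeeSum_mul hA 0
    have h4 : Summable fun j => (C (thetaCoeff k j) * X ^ (j * (j + 1)) : k⟦X⟧) := by
      refine summable_of_finite_not_X_pow_dvd fun n => ?_
      refine (Set.finite_Iio n).subset fun j hj => ?_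
      by_contra hjn
      refine hj (Dvd.dvd.mul_left (pow_dvd_pow X ?_) _)
      have : n ≤ j := by simpa using hjn
      nlinarith
    obtain ⟨U, hU⟩ := h4
    have h5 : HasSum (fun j => C (thetaCoeff k j) * X ^ (j * (j - 1))) (A * S - U) := by
      refine hasSum_of_eq (h3.sub hU) (fun j => ?_) rfl
      ring
    have h6 := (hasSum_nat_add_iff' 1).mpr h5
    -- Reindexing q^{j(j-1)} by j+1 drops its j = 0 term, which is 1. Restoring it at j = 0 gives
    -- the combination θ_j + θ_{j+1} + [j = 0] = t_j.
    have h7 : HasSum (fun j => if j = 0 then (1 : k⟦X⟧) else 0) 1 := hasSum_ite_eq 0 1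
    have h8 := (h7.add hU).add h6
    rw [Finset.sum_range_one] at h8
    refine hasSum_tripleCoeff_eq two_pos ?_ hB hD
    refine hasSum_of_eq h8 (fun j => ?_) ?_
    · have e : 2 * (j * (j + 1) / 2) = j * (j + 1) :=
        Nat.mul_div_cancel' (Nat.even_mul_succ_self j).two_dvd
      rw [e, ← thetaCoeff_add, Nat.add_sub_cancel, mul_comm (j + 1) j, map_add, map_add]
      split_ifs with h
      · subst h
        simp
      · simp
        ring
    · simp only [thetaCoeff, if_true, map_one, zero_mul, pow_zero]
      ring

end PowerSeriesLimits

/-! ### Transfer to Laurent series, infinite products and partitions. -/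

noncomputable section LaurentTransport

open PowerSeries (X C)
open scoped PowerSeries.WithPiTopology

theorem multipliable_of_X_pow_dvd {k : Type*} [Field k] [TopologicalSpace k]
    {f : ℕ → PowerSeries k} (h : ∀ i, X ^ i ∣ f i) : Multipliable fun i => 1 + f i := by
  apply PowerSeries.WithPiTopology.multipliable_one_add_of_tendsto_order_atTop_nhds_top
  refine ENat.tendsto_nhds_top_iff_natCast_lt.mpr
    fun n => Filter.eventually_atTop.mpr ⟨n + 1, fun m hm => ?_⟩
  refine lt_of_lt_of_le (by exact_mod_cast hm) (PowerSeries.nat_le_order _ _ fun i hi => ?_)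
  exact PowerSeries.X_pow_dvd_iff.mp (h m) i hi

theorem hasProd_fin_group {M : Type*} [CommMonoid M] [TopologicalSpace M] [ContinuousMul M]
    [RegularSpace M] {f : ℕ → M} {a : M} (h : HasProd f a) (n : ℕ) [NeZero n] :
    HasProd (fun m => ∏ i ∈ Finset.range n, f (n * m + i)) a := by
  have h1 := (Nat.divModEquiv n).symm.hasProd_iff.mpr h
  refine h1.prod_fiberwise fun m => ?_
  have h2 := hasProd_fintype fun i : Fin n => f (n * m + i)
  rw [Fin.prod_univ_eq_prod_range (fun i => f (n * m + i)) n] at h2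
  convert h2 using 2 with i
  simp [Nat.divModEquiv, mul_comm]

theorem hasSum_fin_group {M : Type*} [AddCommMonoid M] [TopologicalSpace M] [ContinuousAdd M]
    [RegularSpace M] {f : ℕ → M} {a : M} (h : HasSum f a) (n : ℕ) [NeZero n] :
    HasSum (fun m => ∑ i ∈ Finset.range n, f (n * m + i)) a := by
  have h1 := (Nat.divModEquiv n).symm.hasSum_iff.mpr h
  refine h1.prod_fiberwise fun m => ?_
  have h2 := hasSum_fintype fun i : Fin n => f (n * m + i)
  rw [Fin.sum_univ_eq_sum_range (fun i => f (n * m + i)) n] at h2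
  convert h2 using 2 with i
  simp [Nat.divModEquiv, mul_comm]

/-! ### Infinite products -/

/-- `(c q^s;q^t)_∞`. -/
def eulerProd (c : ℚ) (s t : ℕ) : LaurentSeries ℚ :=
  qPochInf (HahnSeries.C c * qVar ^ s) (qVar ^ t)

theorem hasProd_eulerProd (c : ℚ) (s : ℕ) {t : ℕ} (ht : 1 ≤ t) :
    HasProd (fun j => 1 - HahnSeries.C c * qVar ^ (s + t * j)) (eulerProd c s t) := by
  have := (multipliable_qPochInf c s ht).hasProd
  simpa only [pow_add, pow_mul, ← mul_assoc] using! this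

theorem eulerProd_eq_prod (c : ℚ) (s : ℕ) {t : ℕ} (ht : 1 ≤ t) (n : ℕ) [NeZero n] :
    eulerProd c s t = ∏ i ∈ Finset.range n, eulerProd c (s + t * i) (t * n) := by
  refine (hasProd_fin_group (hasProd_eulerProd c s ht) n).unique ?_
  have hn : 1 ≤ t * n := Nat.mul_pos ht (NeZero.pos n)
  convert hasProd_prod (s := Finset.range n) fun i _ =>
    hasProd_eulerProd c (s + t * i) hn using 4 with m i
  ring

theorem eulerProd_mul_neg (s : ℕ) {t : ℕ} (ht : 1 ≤ t) :
    eulerProd 1 s t * eulerProd (-1) s t = eulerProd 1 (2 * s) (2 * t) := by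
  have h1 := (hasProd_eulerProd 1 s ht).mul (hasProd_eulerProd (-1) s ht)
  refine h1.unique ?_
  convert hasProd_eulerProd 1 (2 * s) (t := 2 * t) (by omega) using 2 with j
  rw [map_neg, map_one]
  ring

theorem ofPowerSeries_X_pow (n : ℕ) :
    HahnSeries.ofPowerSeries ℤ ℚ (X ^ n) = qVar ^ n := by
  rw [map_pow, HahnSeries.ofPowerSeries_X, qVar]

theorem exists_hasSum_rogersSzego : ∃ D S : LaurentSeries ℚ,
    HasProd (fun i => 1 - qVar ^ (2 * (i + 1)) + qVar ^ (2 * (2 * i + 2))) D ∧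
    HasSum (fun n => qVar ^ (n * (n - 1)) *
      HahnSeries.ofPowerSeries ℤ ℚ (rogersSzego ℚ (2 * n))) S ∧
    eulerProd 1 1 1 * S = eulerProd 1 2 2 * D ∧ eulerProd 1 1 1 ≠ 0 := by
  let : TopologicalSpace ℚ := ⊥
  have : DiscreteTopology ℚ := ⟨rfl⟩
  have hle {m l : ℕ} (h : m ≤ l) : (X ^ m : PowerSeries ℚ) ∣ X ^ l := pow_dvd_pow X h
  obtain ⟨A, hA⟩ := multipliable_of_X_pow_dvd (k := ℚ) (f := fun i => -X ^ (i + 1))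
    fun i => (hle (by omega)).neg_right
  obtain ⟨B, hB⟩ := multipliable_of_X_pow_dvd (k := ℚ) (f := fun i => -X ^ (2 * (i + 1)))
    fun i => (hle (by omega)).neg_right
  obtain ⟨D, hD⟩ := multipliable_of_X_pow_dvd (k := ℚ)
    (f := fun i => -X ^ (2 * (i + 1)) + X ^ (2 * (2 * i + 2)))
    fun i => dvd_add (hle (by omega)).neg_right (hle (by omega))
  simp only [← sub_eq_add_neg, ← add_assoc] at hA hB hD
  obtain ⟨S, hS, e⟩ := hasSum_rogersSzego hA hB hD
  have hA' := hA.map (HahnSeries.ofPowerSeries ℤ ℚ) continuous_ofPowerSeries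
  have hB' := hB.map (HahnSeries.ofPowerSeries ℤ ℚ) continuous_ofPowerSeries
  have hD' := hD.map (HahnSeries.ofPowerSeries ℤ ℚ) continuous_ofPowerSeries
  have hS' := hS.map (HahnSeries.ofPowerSeries ℤ ℚ) continuous_ofPowerSeries
  have eA : HahnSeries.ofPowerSeries ℤ ℚ A = eulerProd 1 1 1 := by
    refine hA'.unique ?_
    convert hasProd_eulerProd 1 1 le_rfl using 2 with j
    simp only [Function.comp_apply, map_sub, map_one, ofPowerSeries_X_pow]
    ring
  have eB : HahnSeries.ofPowerSeries ℤ ℚ B = eulerProd 1 2 2 := by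
    refine hB'.unique ?_
    convert hasProd_eulerProd 1 2 one_le_two using 2 with j
    simp only [Function.comp_apply, map_sub, map_one, ofPowerSeries_X_pow]
    ring
  refine ⟨HahnSeries.ofPowerSeries ℤ ℚ D, HahnSeries.ofPowerSeries ℤ ℚ S, ?_, ?_, ?_, ?_⟩
  rotate_left 2
  · rw [← eA, ← eB, ← map_mul, e, map_mul]
  -- The Durfee evaluation exhibits an inverse of (q)_∞, which therefore cannot vanish.
  · intro h0
    have := congrArg (HahnSeries.ofPowerSeries ℤ ℚ) (durfeeSum_mul hA 0)
    rw [map_mul, eA, h0, zero_mul, map_one] at this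
    exact zero_ne_one this
  · convert hD' using 2 with i
    simp only [Function.comp_apply, map_sub, map_add, map_one, ofPowerSeries_X_pow]
  · convert hS' using 2 with i
    simp only [Function.comp_apply, map_mul, ofPowerSeries_X_pow]

/-! ### Capparelli partitions -/

theorem sum_capparelli_weight (n : ℕ) :
    (∑ p : n.Partition, p.parts.toFinsupp.prod fun i c =>
      if c = 1 ∧ ¬i ≡ 2 [MOD 6] ∧ ¬i ≡ 4 [MOD 6] then (1 : ℚ) else 0) = capparelliCount n := by
  rw [capparelliCount, Finset.card_filter, Nat.cast_sum]
  refine Finset.sum_congr rfl fun p _ => ?_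
  rw [Finsupp.prod, Finset.prod_ite_zero, Finset.prod_const_one, Nat.cast_ite, Nat.cast_one,
    Nat.cast_zero]
  congr 1
  simp only [Multiset.toFinsupp_support, Multiset.mem_toFinset, Multiset.toFinsupp_apply,
    eq_iff_iff]
  constructor
  · intro h
    refine ⟨Multiset.nodup_iff_count_eq_one.mpr fun i hi => (h i hi).1, fun i hi => (h i hi).2⟩
  · rintro ⟨h1, h2⟩ i hi
    exact ⟨Multiset.nodup_iff_count_eq_one.mp h1 i hi, h2 i hi⟩

theorem hasProd_capparelli :
    HasProd (fun i => 1 + if ¬i + 1 ≡ 2 [MOD 6] ∧ ¬i + 1 ≡ 4 [MOD 6] then qVar ^ (i + 1) else 0)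
      (HahnSeries.ofPowerSeries ℤ ℚ (PowerSeries.mk fun n => (capparelliCount n : ℚ))) := by
  let : TopologicalSpace ℚ := ⊥
  have : DiscreteTopology ℚ := ⟨rfl⟩
  have h := Nat.Partition.hasProd_genFun fun i c =>
      if c = 1 ∧ ¬i ≡ 2 [MOD 6] ∧ ¬i ≡ 4 [MOD 6] then (1 : ℚ) else 0
  simp only [Nat.Partition.genFun, sum_capparelli_weight] at h
  have h' := h.map (HahnSeries.ofPowerSeries ℤ ℚ) continuous_ofPowerSeries
  convert h' using 2 with i
  rw [Function.comp_apply, tsum_eq_single 0]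
  · simp only [zero_add, true_and, mul_one, map_add, map_one]
    split_ifs <;> simp [ofPowerSeries_X_pow]
  · intro j hj
    simp [hj]

/-- Splitting (-q;q²)_∞ into residues 1, 3, 5 modulo 6 lets both sides be compared on blocks of six
consecutive part sizes. -/
theorem capparelli_genFun_eq : eulerProd (-1) 1 2 * eulerProd (-1) 6 6 =
    HahnSeries.ofPowerSeries ℤ ℚ (PowerSeries.mk fun n => (capparelliCount n : ℚ)) := by
  rw [eulerProd_eq_prod (-1) 1 one_le_two 3]
  simp only [Finset.prod_range_succ, Finset.prod_range_zero, one_mul]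
  norm_num
  have h6 : 1 ≤ 6 := by norm_num
  refine HasProd.unique ((((hasProd_eulerProd (-1) 1 h6).mul (hasProd_eulerProd (-1) 3 h6)).mul
    (hasProd_eulerProd (-1) 5 h6)).mul (hasProd_eulerProd (-1) 6 h6)) ?_
  convert hasProd_fin_group hasProd_capparelli 6 using 2 with m
  have hmod (i a : ℕ) : 6 * m + i + 1 ≡ a [MOD 6] ↔ (i + 1) % 6 = a % 6 := by
    rw [Nat.ModEq, show 6 * m + i + 1 = i + 1 + 6 * m by ring, Nat.add_mul_mod_self_left]
  simp only [hmod, Finset.prod_range_succ, Finset.prod_range_zero, map_neg, map_one]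
  norm_num
  ring

end LaurentTransport

/-! ### Regrouping the double sum and simplifying the products. -/

noncomputable section CapparelliSum

theorem one_sub_qVar_pow_ne_zero (n : ℕ) : (1 - qVar ^ (n + 1) : LaurentSeries ℚ) ≠ 0 := by
  rw [← ofPowerSeries_X_pow, ← map_one (HahnSeries.ofPowerSeries ℤ ℚ), ← map_sub]
  refine (map_ne_zero_iff _ HahnSeries.ofPowerSeries_injective).mpr fun h => ?_
  simpa using congrArg PowerSeries.constantCoeff h

theorem qVar_ne_zero : qVar ≠ 0 := by
  simp [qVar]

/-- Pointwise form of the summand: the three parts of the inner sum are consecutive terms of a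
single series. -/
theorem sum_sigma_eq {f : ℕ → LaurentSeries ℚ} (h0 : f 0 = 1) (h1 : (1 - qVar) * f 1 = -1)
    (hf : ∀ n, (1 - qVar ^ (n + 2)) * f (n + 2) = -f (n + 1) - f n) (m : ℕ) :
    (∑ r ∈ Finset.range (2 * m + 1),
        qVar ^ (9 * (m : ℤ) ^ 2 - 3 * (m : ℤ)) * sigma m r *
          (qVar ^ (2 - 6 * (m : ℤ)) *
              (qVar ^ (6 * m) - (1 - qVar ^ (6 * m + 1)) / (1 - qVar ^ (3 * r + 1)))
            + 1
            + qVar ^ (6 * m) / (1 - qVar ^ (6 * m + 2)) * (1 / (1 - qVar ^ (3 * r + 1)) - 1))) =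
      (if m = 0 then 0 else qVar ^ ((3 * m - 1) * (3 * m - 2)) * f (2 * (3 * m - 1))) +
        qVar ^ (3 * m * (3 * m - 1)) * f (2 * (3 * m)) +
        qVar ^ ((3 * m + 1) * (3 * m)) * f (2 * (3 * m + 1)) := by
  obtain ⟨hS, hU⟩ := qPoch_mul_eq_sum_cubicWeight one_sub_qVar_pow_ne_zero h0 h1 hf (2 * m)
  have hQ : qPoch (qVar ^ 2) (qVar ^ 3) (2 * m) ≠ 0 :=
    qPoch_pow_ne_zero one_sub_qVar_pow_ne_zero 1 3 (2 * m)
  have hsig (r : ℕ) : sigma m r = cubicWeight qVar r / qPoch (qVar ^ 3) (qVar ^ 3) (2 * m - r) /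
      qPoch (qVar ^ 2) (qVar ^ 3) (2 * m) := by
    rw [sigma, cubicWeight, div_div, div_div]
    congr 1
    ring
  have hS' : ∑ r ∈ Finset.range (2 * m + 1), sigma m r = f (6 * m) := by
    simp only [hsig]
    rw [← Finset.sum_div, ← hS, mul_div_cancel_left₀ _ hQ]
    congr 1
    ring
  have hU' : ∑ r ∈ Finset.range (2 * m + 1), sigma m r / (1 - qVar ^ (3 * r + 1)) =
      -f (6 * m + 1) := by
    have (r : ℕ) : sigma m r / (1 - qVar ^ (3 * r + 1)) =
        cubicWeight qVar r / (1 - qVar ^ (3 * r + 1)) /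
          qPoch (qVar ^ 3) (qVar ^ 3) (2 * m - r) / qPoch (qVar ^ 2) (qVar ^ 3) (2 * m) := by
      rw [hsig]
      ring
    simp only [this]
    rw [← Finset.sum_div, ← hU, ← mul_neg, mul_div_cancel_left₀ _ hQ,
      show 3 * (2 * m) = 6 * m by ring]
  have key (r : ℕ) : qVar ^ (9 * (m : ℤ) ^ 2 - 3 * (m : ℤ)) * sigma m r *
          (qVar ^ (2 - 6 * (m : ℤ)) *
              (qVar ^ (6 * m) - (1 - qVar ^ (6 * m + 1)) / (1 - qVar ^ (3 * r + 1)))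
            + 1
            + qVar ^ (6 * m) / (1 - qVar ^ (6 * m + 2)) * (1 / (1 - qVar ^ (3 * r + 1)) - 1)) =
      qVar ^ (9 * (m : ℤ) ^ 2 - 3 * (m : ℤ)) * (qVar ^ (2 - 6 * (m : ℤ)) * qVar ^ (6 * m) + 1 -
        qVar ^ (6 * m) / (1 - qVar ^ (6 * m + 2))) * sigma m r +
      qVar ^ (9 * (m : ℤ) ^ 2 - 3 * (m : ℤ)) * (qVar ^ (6 * m) / (1 - qVar ^ (6 * m + 2)) -
        qVar ^ (2 - 6 * (m : ℤ)) * (1 - qVar ^ (6 * m + 1))) *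
          (sigma m r / (1 - qVar ^ (3 * r + 1))) := by
    ring
  simp only [key]
  rw [Finset.sum_add_distrib, ← Finset.mul_sum, ← Finset.mul_sum, hS', hU']
  have e2 := hf (6 * m)
  have hn : (1 - qVar ^ (6 * m + 2) : LaurentSeries ℚ) ≠ 0 := one_sub_qVar_pow_ne_zero (6 * m + 1)
  have hz : (qVar ^ (9 * (m : ℤ) ^ 2 - 3 * (m : ℤ)) : LaurentSeries ℚ) =
      qVar ^ (3 * m * (3 * m - 1)) := by
    rw [← zpow_natCast]
    congr 1
    rcases m with _ | m
    · simp
    · rw [show 3 * (m + 1) - 1 = 3 * m + 2 by omega]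
      push_cast
      ring
  have hz1 : (qVar ^ ((3 * m + 1) * (3 * m)) : LaurentSeries ℚ) =
      qVar ^ (3 * m * (3 * m - 1)) * qVar ^ (6 * m) := by
    rw [← pow_add]
    congr 1
    rcases m with _ | m
    · simp
    · rw [show 3 * (m + 1) - 1 = 3 * m + 2 by omega]
      ring
  -- Two backward steps of the recurrence turn the bracket into f(6m-2). For m = 0 it is f(0) + (1 -
  -- q) f(1) = 0, matching the absent term.
  have hz2 : (if m = 0 then 0 else qVar ^ ((3 * m - 1) * (3 * m - 2)) * f (2 * (3 * m - 1))) =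
      qVar ^ (3 * m * (3 * m - 1)) * (qVar ^ (2 - 6 * (m : ℤ)) *
        (qVar ^ (6 * m) * f (6 * m) + (1 - qVar ^ (6 * m + 1)) * f (6 * m + 1))) := by
    rcases m with _ | m
    · simp only [if_true, mul_zero, pow_zero, zero_add, pow_one, h0, h1]
      ring
    · rw [if_neg m.succ_ne_zero]
      have a1 := hf (6 * m + 5)
      have a2 := hf (6 * m + 4)
      have e : (qVar ^ ((3 * (m + 1) - 1) * (3 * (m + 1) - 2)) : LaurentSeries ℚ) =
          qVar ^ (3 * (m + 1) * (3 * (m + 1) - 1)) * qVar ^ (2 - 6 * ((m + 1 : ℕ) : ℤ)) := by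
        rw [← zpow_natCast, ← zpow_natCast, ← zpow_add₀ qVar_ne_zero,
          show 3 * (m + 1) - 1 = 3 * m + 2 by omega, show 3 * (m + 1) - 2 = 3 * m + 1 by omega]
        congr 1
        push_cast
        ring
      rw [e, show 2 * (3 * (m + 1) - 1) = 6 * m + 4 by omega, mul_assoc]
      congr 2
      rw [show 6 * (m + 1) = 6 * m + 6 by ring]
      linear_combination -a1 + a2
  rw [hz2, hz1, hz, show 2 * (3 * m) = 6 * m by ring, show 2 * (3 * m + 1) = 6 * m + 2 by ring]
  have e3 : f (6 * m + 2) = (-f (6 * m + 1) - f (6 * m)) / (1 - qVar ^ (6 * m + 2)) := by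
    rw [eq_div_iff hn, ← e2, mul_comm]
  rw [e3]
  ring

theorem hasSum_capparelli {S : LaurentSeries ℚ}
    (hS : HasSum (fun n => qVar ^ (n * (n - 1)) *
      HahnSeries.ofPowerSeries ℤ ℚ (rogersSzego ℚ (2 * n))) S) :
    HasSum (fun m : ℕ => ∑ r ∈ Finset.range (2 * m + 1),
        qVar ^ (9 * (m : ℤ) ^ 2 - 3 * (m : ℤ)) * sigma m r *
          (qVar ^ (2 - 6 * (m : ℤ)) *
              (qVar ^ (6 * m) - (1 - qVar ^ (6 * m + 1)) / (1 - qVar ^ (3 * r + 1)))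
            + 1
            + qVar ^ (6 * m) / (1 - qVar ^ (6 * m + 2)) * (1 / (1 - qVar ^ (3 * r + 1)) - 1))) S := by
  set f : ℕ → LaurentSeries ℚ := fun n => HahnSeries.ofPowerSeries ℤ ℚ (rogersSzego ℚ n) with hfd
  have h0 : f 0 = 1 := by simp only [hfd, rogersSzego_zero, map_one]
  have h1 : (1 - qVar) * f 1 = -1 := by
    have := congrArg (HahnSeries.ofPowerSeries ℤ ℚ) (rogersSzego_one (k := ℚ))
    rwa [map_mul, map_sub, map_neg, map_one, ← pow_one PowerSeries.X, ofPowerSeries_X_pow,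
      pow_one] at this
  have hf (n : ℕ) : (1 - qVar ^ (n + 2)) * f (n + 2) = -f (n + 1) - f n := by
    have := congrArg (HahnSeries.ofPowerSeries ℤ ℚ) (rogersSzego_add_two (k := ℚ) n)
    rwa [map_mul, map_sub, map_sub, map_neg, map_one, ofPowerSeries_X_pow] at this
  -- A zero is prepended so that blocks of three starting at 3m hold the original indices 3m-1, 3m,
  -- 3m+1.
  have hshift : HasSum (fun n => if n = 0 then 0 else qVar ^ ((n - 1) * (n - 1 - 1)) *
      f (2 * (n - 1))) S := by
    rw [← hasSum_nat_add_iff' 1]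
    simpa using hS
  refine hasSum_of_eq (hasSum_fin_group hshift 3) (fun m => ?_) rfl
  rw [sum_sigma_eq h0 h1 hf, Finset.sum_range_succ, Finset.sum_range_succ, Finset.sum_range_one,
    add_zero, if_neg (show 3 * m + 1 ≠ 0 by omega), if_neg (show 3 * m + 2 ≠ 0 by omega),
    show 3 * m + 2 - 1 = 3 * m + 1 by omega, Nat.add_sub_cancel,
    show 3 * m - 1 - 1 = 3 * m - 2 by omega]
  congr 3
  simp

/-- The product relations between the infinite products in Capparelli's second identity. -/
theorem eulerProd_relations {D : LaurentSeries ℚ}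
    (hD : HasProd (fun i => 1 - qVar ^ (2 * (i + 1)) + qVar ^ (2 * (2 * i + 2))) D)
    (h1 : eulerProd 1 1 1 ≠ 0) :
    eulerProd 1 2 6 * eulerProd 1 4 6 * eulerProd 1 6 6 *
        (eulerProd 1 2 12 * eulerProd 1 10 12) = eulerProd 1 2 2 * D ∧
      eulerProd 1 2 2 * D = eulerProd 1 1 1 * (eulerProd (-1) 1 2 * eulerProd (-1) 6 6) := by
  have r0 := eulerProd_eq_prod 1 1 (le_refl 1) 6
  have r1 := eulerProd_eq_prod 1 2 one_le_two 3
  have r2 := eulerProd_eq_prod 1 2 (show 1 ≤ 4 by norm_num) 3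
  have r3 := eulerProd_eq_prod 1 2 one_le_two 2
  have r4 := eulerProd_mul_neg 2 one_le_two
  have r5 := eulerProd_eq_prod 1 6 (show 1 ≤ 6 by norm_num) 2
  have r6 := eulerProd_mul_neg 6 (show 1 ≤ 6 by norm_num)
  have r7 := eulerProd_eq_prod 1 1 (le_refl 1) 2
  have r8 := eulerProd_mul_neg 1 one_le_two
  have r9 : D * eulerProd (-1) 2 2 = eulerProd (-1) 6 6 := by
    refine (hD.mul (hasProd_eulerProd (-1) 2 one_le_two)).unique ?_
    convert hasProd_eulerProd (-1) 6 (show 1 ≤ 6 by norm_num) using 2 with j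
    rw [map_neg, map_one]
    ring
  simp only [Finset.prod_range_succ, Finset.prod_range_zero, one_mul] at r0 r1 r2 r3 r5 r7
  norm_num at r0 r1 r2 r3 r4 r5 r6 r7 r8
  have n2 : eulerProd 1 2 2 ≠ 0 := right_ne_zero_of_mul (r7 ▸ h1)
  have n6 : eulerProd 1 6 6 ≠ 0 := right_ne_zero_of_mul (r0 ▸ h1)
  -- Euler's identity with q replaced by q²; `s2` is the same with q⁶.
  have s1 : eulerProd 1 2 4 * eulerProd (-1) 2 2 = 1 := by
    refine mul_left_cancel₀ n2 ?_
    linear_combination eulerProd 1 2 4 * r4 - r3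
  have s2 : eulerProd 1 6 12 * eulerProd (-1) 6 6 = 1 := by
    refine mul_left_cancel₀ n6 ?_
    linear_combination eulerProd 1 6 12 * r6 - r5
  have s3 : D = eulerProd 1 2 4 * eulerProd (-1) 6 6 := by
    linear_combination eulerProd 1 2 4 * r9 - D * s1
  refine ⟨?_, ?_⟩
  · rw [← r1, s3, r2]
    linear_combination -eulerProd 1 2 2 * eulerProd 1 2 12 * eulerProd 1 10 12 * s2
  · rw [s3, r7, ← r8]
    ring

end CapparelliSum

end QSeries

theorem mainTheorem4 :
    HasSum
      (fun m : ℕ => ∑ r ∈ Finset.range (2 * m + 1),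
        QSeries.qVar ^ (9 * (m : ℤ) ^ 2 - 3 * (m : ℤ)) * QSeries.sigma m r *
          (QSeries.qVar ^ (2 - 6 * (m : ℤ)) *
              (QSeries.qVar ^ (6 * m) -
                (1 - QSeries.qVar ^ (6 * m + 1)) / (1 - QSeries.qVar ^ (3 * r + 1)))
            + 1
            + QSeries.qVar ^ (6 * m) / (1 - QSeries.qVar ^ (6 * m + 2)) *
                (1 / (1 - QSeries.qVar ^ (3 * r + 1)) - 1)))
      (QSeries.qPochInf (QSeries.qVar ^ 2) (QSeries.qVar ^ 6) *
          QSeries.qPochInf (QSeries.qVar ^ 4) (QSeries.qVar ^ 6) *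
          QSeries.qPochInf (QSeries.qVar ^ 6) (QSeries.qVar ^ 6) *
          (QSeries.qPochInf (QSeries.qVar ^ 2) (QSeries.qVar ^ 12) *
            QSeries.qPochInf (QSeries.qVar ^ 10) (QSeries.qVar ^ 12)) /
        QSeries.qPochInf QSeries.qVar QSeries.qVar) ∧
    QSeries.qPochInf (QSeries.qVar ^ 2) (QSeries.qVar ^ 6) *
          QSeries.qPochInf (QSeries.qVar ^ 4) (QSeries.qVar ^ 6) *
          QSeries.qPochInf (QSeries.qVar ^ 6) (QSeries.qVar ^ 6) *
          (QSeries.qPochInf (QSeries.qVar ^ 2) (QSeries.qVar ^ 12) *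
            QSeries.qPochInf (QSeries.qVar ^ 10) (QSeries.qVar ^ 12)) /
        QSeries.qPochInf QSeries.qVar QSeries.qVar =
      QSeries.qPochInf (-QSeries.qVar) (QSeries.qVar ^ 2) *
        QSeries.qPochInf (-QSeries.qVar ^ 6) (QSeries.qVar ^ 6) ∧
    ∀ n : ℕ,
      (QSeries.qPochInf (-QSeries.qVar) (QSeries.qVar ^ 2) *
        QSeries.qPochInf (-QSeries.qVar ^ 6) (QSeries.qVar ^ 6)).coeff (n : ℤ) =
      (QSeries.capparelliCount n : ℚ) := by
  have hE (s t : ℕ) : QSeries.qPochInf (QSeries.qVar ^ s) (QSeries.qVar ^ t) =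
      QSeries.eulerProd 1 s t := by
    rw [QSeries.eulerProd, map_one, one_mul]
  have hN (s t : ℕ) : QSeries.qPochInf (-QSeries.qVar ^ s) (QSeries.qVar ^ t) =
      QSeries.eulerProd (-1) s t := by
    rw [QSeries.eulerProd, map_neg, map_one, neg_one_mul]
  have hE1 : QSeries.qPochInf QSeries.qVar QSeries.qVar = QSeries.eulerProd 1 1 1 := by
    simpa using hE 1 1
  have hN1 : QSeries.qPochInf (-QSeries.qVar) (QSeries.qVar ^ 2) = QSeries.eulerProd (-1) 1 2 := by
    simpa using hN 1 2
  obtain ⟨D, S, hD, hS, hAS, hA⟩ := QSeries.exists_hasSum_rogersSzego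
  obtain ⟨e1, e2⟩ := QSeries.eulerProd_relations hD hA
  rw [hE1, hN1, hE, hE, hE, hE, hE, hN, e1]
  refine ⟨?_, ?_, fun n => ?_⟩
  · rw [← hAS, mul_div_cancel_left₀ _ hA]
    exact QSeries.hasSum_capparelli hS
  · rw [e2, mul_div_cancel_left₀ _ hA]
  · rw [QSeries.capparelli_genFun_eq, HahnSeries.ofPowerSeries_apply_coeff, PowerSeries.coeff_mk]
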